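/- For integers $a\ge 2$ and $b\ge 1$ let ${}^{1}a=a$ and ${}^{b+1}a=a^{({}^{b}a)}$, and let $S(a,b)$ be the largest integer $n\ge 0$ with ${}^{b}a\equiv{}^{b+1}a \pmod{10^{n}}$; put $S(a,0)=0$. The congruence speed of $a$ at height $b\ge 1$ is $V(a,b)=S(a,b)-S(a,b-1)$. For a prime $p$ and an integer $d\neq 0$ let $v_p(d)$ be the largest $q\ge 0$ with $p^q\mid d$. Let $a\ge 2$ be an integer that is not a multiple of $10$. Then there is a height $b\ge 1$ such that $V(a,b)=V(a,b+k)$ for all $k\ge 0$; and if $\bar b$ denotes the least such height, the constant congruence speed $V(a):=V(a,\bar b)$ is given by $$ V(a)=\begin{cases} \min\{v_2(a-1),\,v_5(a-1)\} & \text{if } a\equiv 1 \pmod{20},\\ \min\{v_2(a+1),\,v_5(a-1)\} & \text{if } a\equiv 11 \pmod{20},\\ v_5(a^2+1) & \text{if } a\equiv 2 \text{ or } 8 \pmod{10},\\ \min\{v_2(a+1),\,v_5(a^2+1)\} & \text{if } a\equiv 3 \text{ or } 7 \pmod{20},\\ \min\{v_2(a-1),\,v_5(a^2+1)\} & \text{if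 } a\equiv 13 \text{ or } 17 \pmod{20},\\ v_5(a+1) & \text{if } a\equiv 4 \pmod{10},\\ v_2(a-1) & \text{if } a\equiv 5 \pmod{20},\\ v_2(a+1) & \text{if } a\equiv 15 \pmod{20},\\ v_5(a-1) & \text{if } a\equiv 6 \pmod{10},\\ \min\{v_2(a-1),\,v_5(a+1)\} & \text{if } a\equiv 9 \pmod{20},\\ \min\{v_2(a+1),\,v_5(a+1)\} & \text{if } a\equiv 19 \pmod{20}. \end{cases} $$ -/

import Mathlib

namespace Tetration

/-- The tetration (power tower) of base `a` and height `b`: height `1` gives `a`, and height `b + 1`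
gives `a` to the power of the tower of height `b`. (The value `1` at height `0` only serves to
start the recursion.) -/
def tet (a : ℕ) : ℕ → ℕ
  | 0 => 1
  | b + 1 => a ^ tet a b

/-- The number of stable digits of base `a` at height `b ≥ 1`: the largest `n` such that the towers
of heights `b` and `b + 1` are congruent modulo `10 ^ n`, i.e. the exponent of the exact power of
`10` dividing their difference. At height `0` there are no stable digits by convention. -/
noncomputable def stableDigits (a : ℕ) : ℕ → ℕ
  | 0 => 0
  | b + 1 => multiplicity (10 : ℤ) ((tet a (b + 2) : ℤ) - (tet a (b + 1) : ℤ))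

/-- The congruence speed `V(a, b)` at height `b ≥ 1`: the number of new stable digits gained when
passing from height `b - 1` to height `b`. The difference is taken in `ℤ`. -/
noncomputable def congruenceSpeed (a b : ℕ) : ℤ :=
  (stableDigits a b : ℤ) - (stableDigits a (b - 1) : ℤ)

/-- The heights `b ≥ 1` from which on the congruence speed of `a` is constant. -/
def constancyHeights (a : ℕ) : Set ℕ :=
  {b | 1 ≤ b ∧ ∀ k : ℕ, congruenceSpeed a b = congruenceSpeed a (b + k)}

/-- The least height from which on the congruence speed of `a` is constant. -/
noncomputable def optimalHeight (a : ℕ) : ℕ := sInf (constancyHeights a)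

/-- The constant congruence speed `V(a)`. -/
noncomputable def constantCongruenceSpeed (a : ℕ) : ℤ := congruenceSpeed a (optimalHeight a)

theorem tet_lt_tet_succ {a : ℕ} (ha : 2 ≤ a) (b : ℕ) : tet a b < tet a (b + 1) := by
  induction b with
  | zero => simp only [tet, pow_one]; omega
  | succ b ih => exact Nat.pow_lt_pow_right (by omega) ih

/-- `stableDigits a b` is characterized by the exact congruence between consecutive towers. -/
theorem stableDigits_spec {a : ℕ} (ha : 2 ≤ a) {b : ℕ} (hb : 1 ≤ b) :
    tet a b ≡ tet a (b + 1) [MOD 10 ^ stableDigits a b] ∧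
      ¬ tet a b ≡ tet a (b + 1) [MOD 10 ^ (stableDigits a b + 1)] := by
  obtain ⟨b, rfl⟩ : ∃ c, b = c + 1 := ⟨b - 1, by omega⟩
  have hlt := tet_lt_tet_succ ha (b + 1)
  have hfin : FiniteMultiplicity (10 : ℤ) ((tet a (b + 2) : ℤ) - (tet a (b + 1) : ℤ)) := by
    rw [Int.finiteMultiplicity_iff]
    refine ⟨by decide, ?_⟩
    rw [sub_ne_zero]
    exact_mod_cast hlt.ne'
  constructor
  · rw [Nat.modEq_iff_dvd]
    push_cast
    exact pow_multiplicity_dvd _ _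
  · rw [Nat.modEq_iff_dvd]
    push_cast
    exact hfin.not_pow_dvd_of_multiplicity_lt (Nat.lt_succ_self _)

end Tetration

namespace Tetration

/-! Write D_b for `tetDiff a b`. Then D_{b+1} = tet a (b+1) * (a^{D_b} - 1), and the number of
stable digits is min(v_2(D_b), v_5(D_b)). For p ∈ {2, 5} not dividing a, lifting the exponent makes
v_p(D_b) eventually grow by a constant (`padicValNat_two_tetDiff_succ`,
`padicValNat_five_tetDiff_succ`). If p divides a, v_p(D_b) outgrows every linear sequence, so the
other prime decides. The minimum of eventually linear sequences has the smaller slope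
(`EventuallySlope.min`), which is the constant speed; residues of a modulo 4 and 5 simplify the
slopes. -/

instance fact_prime_five : Fact (Nat.Prime 5) := ⟨by norm_num⟩

/-! ### Growth of towers -/

theorem tet_pos {a : ℕ} (ha : 2 ≤ a) (b : ℕ) : 0 < tet a b := by
  cases b with
  | zero => simp [tet]
  | succ b => exact pow_pos (by omega) _

theorem lt_tet {a : ℕ} (ha : 2 ≤ a) (b : ℕ) : b < tet a b := by
  induction b with
  | zero => simp [tet]
  | succ b ih =>
    have := tet_lt_tet_succ ha b
    omega

/-- A quadratic lower bound suffices to beat every linear sequence. -/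
theorem mul_succ_le_two_mul_tet {a : ℕ} (ha : 2 ≤ a) (b : ℕ) : b * (b + 1) ≤ 2 * tet a b := by
  cases b with
  | zero => simp
  | succ b =>
    have h : 2 ^ (b + 1) ≤ tet a (b + 1) :=
      (Nat.pow_le_pow_left ha _).trans (Nat.pow_le_pow_right (by omega) (lt_tet ha b))
    refine le_trans ?_ (Nat.mul_le_mul_left 2 h)
    clear h
    induction b with
    | zero => norm_num
    | succ b ih =>
      have := Nat.lt_two_pow_self (n := b + 1)
      rw [pow_succ]
      nlinarith

/-! ### Valuations of tower differences -/

/-- The difference between the towers of heights `b + 1` and `b`. -/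
def tetDiff (a b : ℕ) : ℕ := tet a (b + 1) - tet a b

theorem tetDiff_ne_zero {a : ℕ} (ha : 2 ≤ a) (b : ℕ) : tetDiff a b ≠ 0 := by
  have := tet_lt_tet_succ ha b
  unfold tetDiff
  omega

theorem tetDiff_succ {a : ℕ} (ha : 2 ≤ a) (b : ℕ) :
    tetDiff a (b + 1) = tet a (b + 1) * (a ^ tetDiff a b - 1) := by
  have h : tet a b + tetDiff a b = tet a (b + 1) := by
    have := tet_lt_tet_succ ha b
    unfold tetDiff
    omega
  rw [Nat.mul_sub, mul_one]
  conv_rhs => rw [tet, ← pow_add, h]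
  rfl

theorem pow_tetDiff_sub_one_ne_zero {a : ℕ} (ha : 2 ≤ a) (b : ℕ) : a ^ tetDiff a b - 1 ≠ 0 := by
  have := Nat.one_lt_pow (tetDiff_ne_zero ha b) (by omega : 1 < a)
  omega

theorem stableDigits_eq_min {a : ℕ} (ha : 2 ≤ a) {b : ℕ} (hb : 1 ≤ b) :
    stableDigits a b = min (padicValNat 2 (tetDiff a b)) (padicValNat 5 (tetDiff a b)) := by
  have hD := tetDiff_ne_zero ha b
  have h25 : ∀ n, tet a b ≡ tet a (b + 1) [MOD 10 ^ n] ↔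
      n ≤ min (padicValNat 2 (tetDiff a b)) (padicValNat 5 (tetDiff a b)) := by
    intro n
    rw [Nat.modEq_iff_dvd' (tet_lt_tet_succ ha b).le, ← tetDiff, le_min_iff,
      ← padicValNat_dvd_iff_le hD, ← padicValNat_dvd_iff_le hD,
      show (10 : ℕ) = 2 * 5 from rfl, mul_pow]
    refine ⟨fun h => ⟨dvd_of_mul_right_dvd h, dvd_of_mul_left_dvd h⟩, fun h => ?_⟩
    exact Nat.Coprime.mul_dvd_of_dvd_of_dvd (Nat.Coprime.pow _ _ (by norm_num)) h.1 h.2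
  obtain ⟨h1, h2⟩ := stableDigits_spec ha hb
  rw [h25] at h1 h2
  omega

theorem padicValNat_tetDiff_succ {a p : ℕ} [Fact p.Prime] (ha : 2 ≤ a) (hp : ¬ p ∣ a) (b : ℕ) :
    padicValNat p (tetDiff a (b + 1)) = padicValNat p (a ^ tetDiff a b - 1) := by
  rw [tetDiff_succ ha, padicValNat.mul (tet_pos ha _).ne' (pow_tetDiff_sub_one_ne_zero ha b), tet,
    padicValNat.eq_zero_of_not_dvd
      (fun h => hp (Nat.Prime.dvd_of_dvd_pow (Fact.out : p.Prime) h)), zero_add]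

theorem tet_le_padicValNat_tetDiff_succ {a p : ℕ} [Fact p.Prime] (ha : 2 ≤ a) (hp : p ∣ a)
    (b : ℕ) : tet a b ≤ padicValNat p (tetDiff a (b + 1)) := by
  rw [← padicValNat_dvd_iff_le (tetDiff_ne_zero ha _), tetDiff_succ ha]
  exact dvd_mul_of_dvd_left (pow_dvd_pow_of_dvd hp _) _

theorem two_dvd_tetDiff {a : ℕ} (h2 : ¬ 2 ∣ a) (b : ℕ) : 2 ∣ tetDiff a b := by
  have hodd : Odd a := by rwa [← Nat.not_even_iff_odd, even_iff_two_dvd]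
  have h (b : ℕ) : Odd (tet a b) := by
    cases b with
    | zero => exact odd_one
    | succ b => exact hodd.pow
  exact (Nat.Odd.sub_odd (h _) (h _)).two_dvd

/-- Allows a^{D_b} to be read as a power of a^4, which is 1 mod 5 when 5 ∤ a. Height 1 fails for a =
2, where D_1 = 2. -/
theorem four_dvd_tetDiff {a : ℕ} (ha : 2 ≤ a) {b : ℕ} (hb : 2 ≤ b) : 4 ∣ tetDiff a b := by
  obtain ⟨b, rfl⟩ : ∃ c, b = c + 2 := ⟨b - 2, by omega⟩
  rw [tetDiff_succ ha]
  by_cases h2 : 2 ∣ a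
  · refine dvd_mul_of_dvd_left ?_ _
    exact (pow_dvd_pow_of_dvd h2 2).trans (pow_dvd_pow a (by have := lt_tet ha (b + 1); omega))
  · refine dvd_mul_of_dvd_right ?_ _
    obtain ⟨k, hk⟩ := two_dvd_tetDiff h2 (b + 1)
    have h1 : a ^ 2 ≡ 1 [MOD 4] := by
      have : a % 4 = 1 ∨ a % 4 = 3 := by omega
      rcases this with h | h <;> simp [Nat.ModEq, Nat.pow_mod, h]
    have h3 := h1.pow k
    rw [one_pow, ← pow_mul, ← hk] at h3
    exact (Nat.modEq_iff_dvd' (Nat.one_le_pow _ _ (by omega))).1 h3.symm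

theorem padicValNat_two_tetDiff_succ {a : ℕ} (ha : 2 ≤ a) (h2 : ¬ 2 ∣ a) (b : ℕ) :
    padicValNat 2 (tetDiff a (b + 1)) + 1 =
      padicValNat 2 (tetDiff a b) + (padicValNat 2 (a + 1) + padicValNat 2 (a - 1)) := by
  have h := padicValNat.pow_two_sub_pow (x := a) (y := 1) (by omega) (by omega) h2
    (tetDiff_ne_zero ha b) (even_iff_two_dvd.2 (two_dvd_tetDiff h2 b))
  rw [one_pow] at h
  rw [padicValNat_tetDiff_succ ha h2, h]
  ring

theorem padicValNat_five_tetDiff_succ {a : ℕ} (ha : 2 ≤ a) (h5 : ¬ 5 ∣ a) {b : ℕ} (hb : 2 ≤ b) :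
    padicValNat 5 (tetDiff a (b + 1)) =
      padicValNat 5 (tetDiff a b) + padicValNat 5 (a ^ 4 - 1) := by
  obtain ⟨k, hk⟩ := four_dvd_tetDiff ha hb
  have hD := tetDiff_ne_zero ha b
  have ha4 : 1 < a ^ 4 := Nat.one_lt_pow (by norm_num) (by omega)
  have hmod : a ^ 4 ≡ 1 [MOD 5] := by
    have : a % 5 = 1 ∨ a % 5 = 2 ∨ a % 5 = 3 ∨ a % 5 = 4 := by omega
    rcases this with h | h | h | h <;> simp [Nat.ModEq, Nat.pow_mod, h]
  have h := padicValNat.pow_sub_pow (p := 5) (x := a ^ 4) (y := 1) (by decide) ha4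
    ((Nat.modEq_iff_dvd' ha4.le).1 hmod.symm)
    (fun h => h5 (Nat.Prime.dvd_of_dvd_pow (by norm_num) h)) (n := k) (by rintro rfl; omega)
  rw [one_pow, ← pow_mul, ← hk] at h
  -- D_b = 4k and 5 ∤ 4, so k and D_b have the same 5-adic valuation.
  rw [padicValNat_tetDiff_succ ha h5, h, hk, padicValNat.mul (by norm_num) (by rintro rfl; omega),
    padicValNat.eq_zero_of_not_dvd (by norm_num : ¬ 5 ∣ 4), zero_add, add_comm]

/-! ### Eventually linear sequences -/

/-- The sequence `f` eventually grows by `s` at every step. -/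
def EventuallySlope (f : ℕ → ℕ) (s : ℕ) : Prop := ∃ B, ∀ b ≥ B, f (b + 1) = f b + s

theorem eq_add_mul_of_step {f : ℕ → ℕ} {s B C : ℕ} (hf : ∀ b ≥ B, f (b + 1) = f b + s)
    (hC : B ≤ C) (k : ℕ) : f (C + k) = f C + k * s := by
  induction k with
  | zero => simp
  | succ k ih => rw [← add_assoc, hf _ (by omega), ih]; ring

theorem EventuallySlope.min_left {f g : ℕ → ℕ} {s : ℕ} (hf : EventuallySlope f s)
    (h : ∃ B, ∀ b ≥ B, f b ≤ g b) : EventuallySlope (fun b => min (f b) (g b)) s := by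
  obtain ⟨B, hB⟩ := hf
  obtain ⟨C, hC⟩ := h
  refine ⟨max B C, fun b hb => ?_⟩
  have := hB b (by omega)
  have := hC b (by omega)
  have := hC (b + 1) (by omega)
  dsimp only
  omega

theorem EventuallySlope.min_right {f g : ℕ → ℕ} {s : ℕ} (hg : EventuallySlope g s)
    (h : ∃ B, ∀ b ≥ B, g b ≤ f b) : EventuallySlope (fun b => min (f b) (g b)) s := by
  simpa only [min_comm] using hg.min_left h

theorem EventuallySlope.eventually_le {f g : ℕ → ℕ} {s t : ℕ} (hf : EventuallySlope f s)
    (hg : EventuallySlope g t) (hst : s < t) : ∃ B, ∀ b ≥ B, f b ≤ g b := by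
  obtain ⟨B, hB⟩ := hf
  obtain ⟨C, hC⟩ := hg
  -- Past `max B C`, g gains at least 1 on f per step, so `f (max B C)` steps absorb any initial
  -- lead.
  refine ⟨max B C + f (max B C), fun b hb => ?_⟩
  obtain ⟨k, rfl⟩ := Nat.exists_eq_add_of_le (le_of_add_le_left hb)
  rw [eq_add_mul_of_step hB (le_max_left B C), eq_add_mul_of_step hC (le_max_right B C)]
  have : k * (s + 1) ≤ k * t := Nat.mul_le_mul_left k hst
  rw [mul_add] at this
  omega

theorem EventuallySlope.min {f g : ℕ → ℕ} {s t : ℕ} (hf : EventuallySlope f s)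
    (hg : EventuallySlope g t) : EventuallySlope (fun b => min (f b) (g b)) (min s t) := by
  rcases lt_trichotomy s t with h | rfl | h
  · rw [min_eq_left h.le]
    exact hf.min_left (hf.eventually_le hg h)
  · obtain ⟨B, hB⟩ := hf
    obtain ⟨C, hC⟩ := hg
    refine ⟨max B C, fun b hb => ?_⟩
    have := hB b (by omega)
    have := hC b (by omega)
    dsimp only
    omega
  · rw [min_eq_right h.le]
    exact hg.min_right (hg.eventually_le hf h)

theorem EventuallySlope.eventually_le_padicValNat {a p : ℕ} [Fact p.Prime] (ha : 2 ≤ a)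
    (hp : p ∣ a) {f : ℕ → ℕ} {s : ℕ} (hf : EventuallySlope f s) :
    ∃ B, ∀ b ≥ B, f b ≤ padicValNat p (tetDiff a b) := by
  obtain ⟨B, hB⟩ := hf
  -- With b = m + 1 this forces m ≥ 2 * f B + 2 * s, whence f B + (m + 1) * s ≤ m * (m + 1) / 2 ≤
  -- tet a m.
  refine ⟨B + 2 * f B + 2 * s + 1, fun b hb => ?_⟩
  obtain ⟨k, rfl⟩ := Nat.exists_eq_add_of_le (show B ≤ b by omega)
  obtain ⟨m, hm⟩ : ∃ m, B + k = m + 1 := ⟨B + k - 1, by omega⟩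
  rw [eq_add_mul_of_step hB le_rfl, hm]
  refine le_trans ?_ (tet_le_padicValNat_tetDiff_succ ha hp m)
  have h1 : m * (m + 1) ≤ 2 * tet a m := mul_succ_le_two_mul_tet ha m
  have h2 : (2 * f B + 2 * s) * (m + 1) ≤ m * (m + 1) := Nat.mul_le_mul_right _ (by omega)
  have h3 : k * s ≤ (m + 1) * s := Nat.mul_le_mul_right _ (by omega)
  nlinarith [Nat.zero_le (f B * m)]

theorem EventuallySlope.congruenceSpeed {a s : ℕ} (h : EventuallySlope (stableDigits a) s) :
    (constancyHeights a).Nonempty ∧ constantCongruenceSpeed a = s := by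
  obtain ⟨B, hB⟩ := h
  have hV (b : ℕ) (hb : B + 1 ≤ b) : Tetration.congruenceSpeed a b = s := by
    obtain ⟨c, rfl⟩ : ∃ c, b = c + 1 := ⟨b - 1, by omega⟩
    rw [Tetration.congruenceSpeed, Nat.add_sub_cancel, hB c (by omega)]
    push_cast
    ring
  have hne : (constancyHeights a).Nonempty :=
    ⟨B + 1, by omega, fun k => by rw [hV _ le_rfl, hV _ (by omega)]⟩
  refine ⟨hne, ?_⟩
  have hmem : optimalHeight a ∈ constancyHeights a := Nat.sInf_mem hne
  -- The least height may lie below B + 1; constancy carries its speed to a height where `hV`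
  -- applies.
  rw [constantCongruenceSpeed, hmem.2 (B + 1), hV _ (by omega)]

/-! ### Speed by divisibility of a by 2 and 5 -/

theorem eventuallySlope_two {a : ℕ} (ha : 2 ≤ a) (h2 : ¬ 2 ∣ a) :
    EventuallySlope (fun b => padicValNat 2 (tetDiff a b))
      (padicValNat 2 (a + 1) + padicValNat 2 (a - 1) - 1) := by
  refine ⟨0, fun b _ => ?_⟩
  have := padicValNat_two_tetDiff_succ ha h2 b
  have : 1 ≤ padicValNat 2 (a + 1) := one_le_padicValNat_of_dvd (by omega) (by omega)
  dsimp only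
  omega

theorem eventuallySlope_five {a : ℕ} (ha : 2 ≤ a) (h5 : ¬ 5 ∣ a) :
    EventuallySlope (fun b => padicValNat 5 (tetDiff a b)) (padicValNat 5 (a ^ 4 - 1)) :=
  ⟨2, fun _ hb => padicValNat_five_tetDiff_succ ha h5 hb⟩

theorem eventuallySlope_stableDigits {a : ℕ} (ha : 2 ≤ a) {s : ℕ}
    (h : EventuallySlope
      (fun b => min (padicValNat 2 (tetDiff a b)) (padicValNat 5 (tetDiff a b))) s) :
    EventuallySlope (stableDigits a) s := by
  obtain ⟨B, hB⟩ := h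
  -- Height 0 is avoided: `stableDigits` is 0 there by convention, not the minimum.
  refine ⟨B + 1, fun b hb => ?_⟩
  rw [stableDigits_eq_min ha (by omega), stableDigits_eq_min ha (by omega)]
  exact hB b (by omega)

theorem speed_of_coprime {a : ℕ} (ha : 2 ≤ a) (h2 : ¬ 2 ∣ a) (h5 : ¬ 5 ∣ a) :
    (constancyHeights a).Nonempty ∧ constantCongruenceSpeed a =
      (min (padicValNat 2 (a + 1) + padicValNat 2 (a - 1) - 1) (padicValNat 5 (a ^ 4 - 1)) : ℕ) :=
  (eventuallySlope_stableDigits ha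
    ((eventuallySlope_two ha h2).min (eventuallySlope_five ha h5))).congruenceSpeed

theorem speed_of_two_dvd {a : ℕ} (ha : 2 ≤ a) (h2 : 2 ∣ a) (h5 : ¬ 5 ∣ a) :
    (constancyHeights a).Nonempty ∧ constantCongruenceSpeed a = padicValNat 5 (a ^ 4 - 1) :=
  (eventuallySlope_stableDigits ha ((eventuallySlope_five ha h5).min_right
    ((eventuallySlope_five ha h5).eventually_le_padicValNat ha h2))).congruenceSpeed

theorem speed_of_five_dvd {a : ℕ} (ha : 2 ≤ a) (h2 : ¬ 2 ∣ a) (h5 : 5 ∣ a) :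
    (constancyHeights a).Nonempty ∧ constantCongruenceSpeed a =
      (padicValNat 2 (a + 1) + padicValNat 2 (a - 1) - 1 : ℕ) :=
  (eventuallySlope_stableDigits ha ((eventuallySlope_two ha h2).min_left
    ((eventuallySlope_two ha h2).eventually_le_padicValNat ha h5))).congruenceSpeed

/-! ### Slopes by residue class -/

theorem padicValNat_two_eq_one {n : ℕ} (h : n % 4 = 2) : padicValNat 2 n = 1 := by
  have h1 : 1 ≤ padicValNat 2 n := one_le_padicValNat_of_dvd (by omega) (by omega)
  have h2 : ¬ 2 ≤ padicValNat 2 n := by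
    rw [← padicValNat_dvd_iff_le (by omega)]
    omega
  omega

/-- The neighbour of a that is 2 mod 4 contributes exactly 1, cancelling the -1. -/
theorem slope_two_of_one_mod_four {a : ℕ} (h : a % 4 = 1) :
    padicValNat 2 (a + 1) + padicValNat 2 (a - 1) - 1 = padicValNat 2 (a - 1) := by
  rw [padicValNat_two_eq_one (by omega : (a + 1) % 4 = 2), Nat.add_sub_cancel_left]

theorem slope_two_of_three_mod_four {a : ℕ} (h : a % 4 = 3) :
    padicValNat 2 (a + 1) + padicValNat 2 (a - 1) - 1 = padicValNat 2 (a + 1) := by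
  rw [padicValNat_two_eq_one (by omega : (a - 1) % 4 = 2), Nat.add_sub_cancel]

/-- For p = 5 and 5 ∤ a, only one of the three factors is divisible by 5, selected by a mod 5. -/
theorem padicValNat_pow_four_sub_one {a : ℕ} (ha : 2 ≤ a) (p : ℕ) [Fact p.Prime] :
    padicValNat p (a ^ 4 - 1) =
      padicValNat p (a - 1) + padicValNat p (a + 1) + padicValNat p (a ^ 2 + 1) := by
  have h : a ^ 4 - 1 = (a - 1) * (a + 1) * (a ^ 2 + 1) := by
    obtain ⟨c, rfl⟩ : ∃ c, a = c + 1 := ⟨a - 1, by omega⟩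
    rw [Nat.add_sub_cancel]
    refine Nat.sub_eq_of_eq_add ?_
    ring
  rw [h, padicValNat.mul (Nat.mul_ne_zero (by omega) (by omega)) (by positivity),
    padicValNat.mul (by omega) (by omega)]

theorem not_five_dvd_sq_add_one {a : ℕ} (h : a % 5 = 1 ∨ a % 5 = 4) : ¬ 5 ∣ a ^ 2 + 1 := by
  rcases h with h | h <;> simp [Nat.dvd_iff_mod_eq_zero, Nat.add_mod, Nat.pow_mod, h]

theorem slope_five_of_one_mod_five {a : ℕ} (ha : 2 ≤ a) (h : a % 5 = 1) :
    padicValNat 5 (a ^ 4 - 1) = padicValNat 5 (a - 1) := by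
  rw [padicValNat_pow_four_sub_one ha,
    padicValNat.eq_zero_of_not_dvd (by omega : ¬ 5 ∣ a + 1),
    padicValNat.eq_zero_of_not_dvd (not_five_dvd_sq_add_one (.inl h))]
  rfl

theorem slope_five_of_four_mod_five {a : ℕ} (ha : 2 ≤ a) (h : a % 5 = 4) :
    padicValNat 5 (a ^ 4 - 1) = padicValNat 5 (a + 1) := by
  rw [padicValNat_pow_four_sub_one ha,
    padicValNat.eq_zero_of_not_dvd (by omega : ¬ 5 ∣ a - 1),
    padicValNat.eq_zero_of_not_dvd (not_five_dvd_sq_add_one (.inr h)), zero_add]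
  rfl

theorem slope_five_of_two_or_three_mod_five {a : ℕ} (ha : 2 ≤ a) (h : a % 5 = 2 ∨ a % 5 = 3) :
    padicValNat 5 (a ^ 4 - 1) = padicValNat 5 (a ^ 2 + 1) := by
  rw [padicValNat_pow_four_sub_one ha,
    padicValNat.eq_zero_of_not_dvd (by omega : ¬ 5 ∣ a - 1),
    padicValNat.eq_zero_of_not_dvd (by omega : ¬ 5 ∣ a + 1), zero_add, zero_add]

end Tetration

theorem corollary2p2 (a : ℕ) (ha : 2 ≤ a) (h10 : ¬ a ≡ 0 [MOD 10]) :
    (Tetration.constancyHeights a).Nonempty ∧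
    (a ≡ 1 [MOD 20] → Tetration.constantCongruenceSpeed a =
      ((min (padicValNat 2 (a - 1)) (padicValNat 5 (a - 1)) : ℕ) : ℤ)) ∧
    (a ≡ 11 [MOD 20] → Tetration.constantCongruenceSpeed a =
      ((min (padicValNat 2 (a + 1)) (padicValNat 5 (a - 1)) : ℕ) : ℤ)) ∧
    (a ≡ 2 [MOD 10] ∨ a ≡ 8 [MOD 10] → Tetration.constantCongruenceSpeed a =
      (padicValNat 5 (a ^ 2 + 1) : ℤ)) ∧
    (a ≡ 3 [MOD 20] ∨ a ≡ 7 [MOD 20] → Tetration.constantCongruenceSpeed a =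
      ((min (padicValNat 2 (a + 1)) (padicValNat 5 (a ^ 2 + 1)) : ℕ) : ℤ)) ∧
    (a ≡ 13 [MOD 20] ∨ a ≡ 17 [MOD 20] → Tetration.constantCongruenceSpeed a =
      ((min (padicValNat 2 (a - 1)) (padicValNat 5 (a ^ 2 + 1)) : ℕ) : ℤ)) ∧
    (a ≡ 4 [MOD 10] → Tetration.constantCongruenceSpeed a = (padicValNat 5 (a + 1) : ℤ)) ∧
    (a ≡ 5 [MOD 20] → Tetration.constantCongruenceSpeed a = (padicValNat 2 (a - 1) : ℤ)) ∧
    (a ≡ 15 [MOD 20] → Tetration.constantCongruenceSpeed a = (padicValNat 2 (a + 1) : ℤ)) ∧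
    (a ≡ 6 [MOD 10] → Tetration.constantCongruenceSpeed a = (padicValNat 5 (a - 1) : ℤ)) ∧
    (a ≡ 9 [MOD 20] → Tetration.constantCongruenceSpeed a =
      ((min (padicValNat 2 (a - 1)) (padicValNat 5 (a + 1)) : ℕ) : ℤ)) ∧
    (a ≡ 19 [MOD 20] → Tetration.constantCongruenceSpeed a =
      ((min (padicValNat 2 (a + 1)) (padicValNat 5 (a + 1)) : ℕ) : ℤ)) := by

  simp only [Nat.ModEq] at h10 ⊢
  refine ⟨?_, fun h => ?_, fun h => ?_, fun h => ?_, fun h => ?_, fun h => ?_, fun h => ?_,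
    fun h => ?_, fun h => ?_, fun h => ?_, fun h => ?_, fun h => ?_⟩
  · by_cases h2 : 2 ∣ a
    · exact (Tetration.speed_of_two_dvd ha h2 (by omega)).1
    · by_cases h5 : 5 ∣ a
      · exact (Tetration.speed_of_five_dvd ha h2 h5).1
      · exact (Tetration.speed_of_coprime ha h2 h5).1
  · rw [(Tetration.speed_of_coprime ha (by omega) (by omega)).2,
      Tetration.slope_two_of_one_mod_four (by omega),
      Tetration.slope_five_of_one_mod_five ha (by omega)]
  · rw [(Tetration.speed_of_coprime ha (by omega) (by omega)).2,
      Tetration.slope_two_of_three_mod_four (by omega),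
      Tetration.slope_five_of_one_mod_five ha (by omega)]
  · rw [(Tetration.speed_of_two_dvd ha (by omega) (by omega)).2,
      Tetration.slope_five_of_two_or_three_mod_five ha (by omega)]
  · rw [(Tetration.speed_of_coprime ha (by omega) (by omega)).2,
      Tetration.slope_two_of_three_mod_four (by omega),
      Tetration.slope_five_of_two_or_three_mod_five ha (by omega)]
  · rw [(Tetration.speed_of_coprime ha (by omega) (by omega)).2,
      Tetration.slope_two_of_one_mod_four (by omega),
      Tetration.slope_five_of_two_or_three_mod_five ha (by omega)]
  · rw [(Tetration.speed_of_two_dvd ha (by omega) (by omega)).2,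
      Tetration.slope_five_of_four_mod_five ha (by omega)]
  · rw [(Tetration.speed_of_five_dvd ha (by omega) (by omega)).2,
      Tetration.slope_two_of_one_mod_four (by omega)]
  · rw [(Tetration.speed_of_five_dvd ha (by omega) (by omega)).2,
      Tetration.slope_two_of_three_mod_four (by omega)]
  · rw [(Tetration.speed_of_two_dvd ha (by omega) (by omega)).2,
      Tetration.slope_five_of_one_mod_five ha (by omega)]
  · rw [(Tetration.speed_of_coprime ha (by omega) (by omega)).2,
      Tetration.slope_two_of_one_mod_four (by omega),
      Tetration.slope_five_of_four_mod_five ha (by omega)]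
  · rw [(Tetration.speed_of_coprime ha (by omega) (by omega)).2,
      Tetration.slope_two_of_three_mod_four (by omega),
      Tetration.slope_five_of_four_mod_five ha (by omega)]
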